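/- A \emph{finite space} is a finite $T_0$ topological space, equivalently a finite poset whose open sets are its ideals (the subsets $Q$ such that $x\le y\in Q$ implies $x\in Q$); a map of finite spaces is continuous if and only if it is order-preserving. For $m\ge 0$ let $J_m$ be the fence $0<1>2<\cdots m$ with $m+1$ points, let $P^{J_m}$ be the finite space of continuous maps $J_m\to P$ with the pointwise order, and let $q_m:P^{J_m}\to P\times P$, $q_m(\gamma)=(\gamma(0),\gamma(m))$. For a path-connected finite space $P$, $\mathrm{CC}_m(P)\in\{0,1,2,\dots,\infty\}$ is the least $n$ such that $P\times P$ has an open cover $Q_1,\dots,Q_n$ with a continuous section $Q_i\to P^{J_m}$ of $q_m$ for each $i$ ($\infty$ if there is none), and the \emph{combinatorial complexity} is $\mathrm{CC}(P)=\min_{m\ge 0}\mathrm{CC}_m(P)$. The \emph{order complex} $\mathcal{K}(P)$ is the (geometrically realized) simplicial complex whose simplices are the nonempty chains of $P$. For a finite path-connected CW complex $X$, the \emph{topological cellular complexity} $\mathrm{TCC}(X)$ is the least $n$ such that $X\times X$, with the CW structure whose cells are the products of cells of $X$, is covered by subcomplexes $Y_1,\dots,Y_n$, each with a continuous section $Y_i\to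 X^{[0,1]}$ of the path fibration $\gamma\mapsto(\gamma(0),\gamma(1))$ ($\infty$ if there is none). \textbf{Theorem.} For every path-connected finite space $P$, $$\mathrm{TCC}(\mathcal{K}(P))\le \mathrm{CC}(P).$$ -/

import Mathlib

open Topology Metric Set

/-! ### Finite spaces, fences and combinatorial complexity

A finite space (finite `T₀` space) is a finite poset whose open sets are the ideals (lower sets),
i.e. a type with `[PartialOrder P] [Finite P] [TopologicalSpace P] [Topology.IsLowerSet P]`. -/

/-- The points `0, 1, …, m` of the finite fence `J_m`. -/
def Fence (m : ℕ) : Type := Fin (m + 1)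

namespace Fence

/-- The point `i` of the fence as a natural number. -/
def toNat {m : ℕ} (i : Fence m) : ℕ := Fin.val i

/-- The initial point `0` of the fence. -/
def first (m : ℕ) : Fence m := (0 : Fin (m + 1))

/-- The final point `m` of the fence. -/
def last (m : ℕ) : Fence m := Fin.last m

/-- The zigzag order `0 < 1 > 2 < ⋯ m`: besides equality, the only relations are that
an even point lies below the (odd) points adjacent to it. -/
instance (m : ℕ) : PartialOrder (Fence m) where
  le i j := i = j ∨ (Even i.toNat ∧ (j.toNat = i.toNat + 1 ∨ i.toNat = j.toNat + 1))
  le_refl i := Or.inl rfl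
  le_trans i j k := by
    rintro (rfl | ⟨hi, hij⟩) (rfl | ⟨hj, hjk⟩)
    · exact Or.inl rfl
    · exact Or.inr ⟨hj, hjk⟩
    · exact Or.inr ⟨hi, hij⟩
    · rcases hij with h | h <;> grind
  le_antisymm i j := by
    rintro (rfl | ⟨hi, hij⟩) (h | ⟨hj, hjk⟩)
    · rfl
    · rfl
    · exact h.symm
    · grind

/-- The fence as a finite space. -/
instance (m : ℕ) : TopologicalSpace (Fence m) := Topology.lowerSet (Fence m)

instance (m : ℕ) : Topology.IsLowerSet (Fence m) := ⟨rfl⟩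

end Fence

/-- The space `P^{J_m}` of combinatorial paths of length `m`: continuous maps `J_m → P`. -/
def CombPath (P : Type*) [TopologicalSpace P] (m : ℕ) : Type _ :=
  {γ : Fence m → P // Continuous γ}

namespace CombPath

/-- The pointwise order on combinatorial paths. -/
instance {P : Type*} [PartialOrder P] [TopologicalSpace P] (m : ℕ) :
    PartialOrder (CombPath P m) :=
  inferInstanceAs (PartialOrder {γ : Fence m → P // Continuous γ})

/-- `P^{J_m}` as a finite space: the topology whose open sets are the ideals of the
pointwise order. -/
instance {P : Type*} [PartialOrder P] [TopologicalSpace P] (m : ℕ) :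
    TopologicalSpace (CombPath P m) :=
  Topology.lowerSet (CombPath P m)

instance {P : Type*} [PartialOrder P] [TopologicalSpace P] (m : ℕ) :
    Topology.IsLowerSet (CombPath P m) := ⟨rfl⟩

/-- The endpoint map `q_m : P^{J_m} → P × P`, `γ ↦ (γ(0), γ(m))`. -/
def endpoints {P : Type*} [TopologicalSpace P] {m : ℕ} (γ : CombPath P m) : P × P :=
  (γ.1 (Fence.first m), γ.1 (Fence.last m))

end CombPath

/-- `CC_m(P)`: the least `n` such that `P × P` has an open cover `Q_1, …, Q_n` with continuous
sections `Q_i → P^{J_m}` of `q_m`; it is `∞` if there is no such `n`. -/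
noncomputable def combComplexityAt (P : Type*) [PartialOrder P] [TopologicalSpace P] (m : ℕ) :
    ℕ∞ :=
  ⨅ (n : ℕ) (_ : ∃ Q : Fin n → Set (P × P),
      (∀ i, IsOpen (Q i)) ∧ (⋃ i, Q i) = univ ∧
      ∀ i, ∃ s : Q i → CombPath P m, Continuous s ∧ ∀ z : Q i, (s z).endpoints = (z : P × P)),
    (n : ℕ∞)

/-- The combinatorial complexity `CC(P)`: the minimum of `CC_m(P)` over `m ≥ 0`. -/
noncomputable def combComplexity (P : Type*) [PartialOrder P] [TopologicalSpace P] : ℕ∞ :=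
  ⨅ m : ℕ, combComplexityAt P m

/-! ### Products of finite CW complexes -/

namespace CWProd

/-- The cells of dimension `n` of a product: pairs of cells whose dimensions add up to `n`. -/
abbrev Cell {X Y : Type*} [TopologicalSpace X] [TopologicalSpace Y] (C : Set X) (D : Set Y)
    [CWComplex C] [CWComplex D] (n : ℕ) : Type _ :=
  Σ p : {p : ℕ × ℕ // p.1 + p.2 = n}, RelCWComplex.cell C p.1.1 × RelCWComplex.cell D p.1.2

/-- The splitting `ℝⁿ ≃ ℝᵏ × ℝˡ` for `k + l = n`, an isometry for the maximum norms. -/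
noncomputable def split {k l n : ℕ} (h : k + l = n) :
    (Fin n → ℝ) ≃ᵢ (Fin k → ℝ) × (Fin l → ℝ) :=
  (Fin.appendIsometryOfEq h).symm

theorem split_zero {k l n : ℕ} (h : k + l = n) : split h 0 = 0 := by
  subst h
  ext i <;> rfl

theorem norm_split {k l n : ℕ} (h : k + l = n) (v : Fin n → ℝ) : ‖split h v‖ = ‖v‖ := by
  have := (split h).dist_eq v 0
  rwa [split_zero, dist_zero_right, dist_zero_right] at this

/-- The characteristic map of a product of two cells: the product of the characteristic maps. -/
noncomputable def map {X Y : Type*} [TopologicalSpace X] [TopologicalSpace Y] {C : Set X}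
    {D : Set Y} [CWComplex C] [CWComplex D] (n : ℕ) (c : Cell C D n) :
    PartialEquiv (Fin n → ℝ) (X × Y) :=
  (split c.1.2).toEquiv.transPartialEquiv
    ((RelCWComplex.map (C := C) c.1.1.1 c.2.1).prod (RelCWComplex.map (C := D) c.1.1.2 c.2.2))

section
variable {X Y : Type*} [TopologicalSpace X] [TopologicalSpace Y] {C : Set X}
    {D : Set Y} [CWComplex C] [CWComplex D]

theorem map_apply (n : ℕ) (c : Cell C D n) (v : Fin n → ℝ) :
    map n c v = (RelCWComplex.map (C := C) c.1.1.1 c.2.1 (split c.1.2 v).1,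
      RelCWComplex.map (C := D) c.1.1.2 c.2.2 (split c.1.2 v).2) := rfl

theorem image_ball (n : ℕ) (c : Cell C D n) :
    map n c '' ball 0 1 =
      RelCWComplex.openCell (C := C) c.1.1.1 c.2.1 ×ˢ RelCWComplex.openCell (C := D) c.1.1.2 c.2.2 := by
  ext ⟨x, y⟩
  constructor
  · rintro ⟨v, hv, hxy⟩
    rw [mem_ball_zero_iff, ← norm_split c.1.2, Prod.norm_def, max_lt_iff] at hv
    rw [map_apply, Prod.mk.injEq] at hxy
    exact ⟨⟨_, mem_ball_zero_iff.2 hv.1, hxy.1⟩, ⟨_, mem_ball_zero_iff.2 hv.2, hxy.2⟩⟩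
  · rintro ⟨⟨a, ha, rfl⟩, ⟨b, hb, rfl⟩⟩
    refine ⟨(split c.1.2).symm (a, b), ?_, ?_⟩
    · rw [mem_ball_zero_iff, ← norm_split c.1.2, IsometryEquiv.apply_symm_apply, Prod.norm_def,
        max_lt_iff]
      exact ⟨mem_ball_zero_iff.1 ha, mem_ball_zero_iff.1 hb⟩
    · rw [map_apply, IsometryEquiv.apply_symm_apply]

theorem image_closedBall (n : ℕ) (c : Cell C D n) :
    map n c '' closedBall 0 1 =
      RelCWComplex.closedCell (C := C) c.1.1.1 c.2.1 ×ˢ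
        RelCWComplex.closedCell (C := D) c.1.1.2 c.2.2 := by
  ext ⟨x, y⟩
  constructor
  · rintro ⟨v, hv, hxy⟩
    rw [mem_closedBall_zero_iff, ← norm_split c.1.2, Prod.norm_def, max_le_iff] at hv
    rw [map_apply, Prod.mk.injEq] at hxy
    exact ⟨⟨_, mem_closedBall_zero_iff.2 hv.1, hxy.1⟩, ⟨_, mem_closedBall_zero_iff.2 hv.2, hxy.2⟩⟩
  · rintro ⟨⟨a, ha, rfl⟩, ⟨b, hb, rfl⟩⟩
    refine ⟨(split c.1.2).symm (a, b), ?_, ?_⟩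
    · rw [mem_closedBall_zero_iff, ← norm_split c.1.2, IsometryEquiv.apply_symm_apply,
        Prod.norm_def, max_le_iff]
      exact ⟨mem_closedBall_zero_iff.1 ha, mem_closedBall_zero_iff.1 hb⟩
    · rw [map_apply, IsometryEquiv.apply_symm_apply]

end

end CWProd

/-- The product of two finite CW complexes (with the product topology), whose cells are the
products of cells. -/
noncomputable instance CWProd.instCWComplex {X Y : Type*} [TopologicalSpace X]
    [TopologicalSpace Y] (C : Set X) (D : Set Y) [CWComplex C] [CWComplex D]
    [RelCWComplex.Finite C] [RelCWComplex.Finite D] : CWComplex (C ×ˢ D) :=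
  CWComplex.mkFinite (C ×ˢ D)
    (cell := CWProd.Cell C D)
    (map := CWProd.map)
    (eventually_isEmpty_cell := by
      have hC : ∀ᶠ n in Filter.atTop, IsEmpty (RelCWComplex.cell C n) :=
        RelCWComplex.FiniteDimensional.eventually_isEmpty_cell
      have hD : ∀ᶠ n in Filter.atTop, IsEmpty (RelCWComplex.cell D n) :=
        RelCWComplex.FiniteDimensional.eventually_isEmpty_cell
      obtain ⟨N, hN⟩ := Filter.eventually_atTop.1 hC
      obtain ⟨M, hM⟩ := Filter.eventually_atTop.1 hD
      refine Filter.eventually_atTop.2 ⟨N + M, fun n hn => ⟨?_⟩⟩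
      rintro ⟨⟨⟨k, l⟩, hkl⟩, i, j⟩
      simp only at hkl i j
      rcases le_or_gt N k with h | h
      · exact (hN k h).false i
      · exact (hM l (by omega)).false j)
    (finite_cell := fun n => by
      have h1 : ∀ k, _root_.Finite (RelCWComplex.cell C k) :=
        RelCWComplex.FiniteType.finite_cell (C := C)
      have h2 : ∀ k, _root_.Finite (RelCWComplex.cell D k) :=
        RelCWComplex.FiniteType.finite_cell (C := D)
      have h3 : _root_.Finite {p : ℕ × ℕ // p.1 + p.2 = n} := by
        have := (Finset.HasAntidiagonal.antidiagonal n).finite_toSet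
        simpa [Finset.mem_antidiagonal, Set.Finite] using this
      infer_instance)
    (source_eq := fun n c => by
      ext v
      have h1 := RelCWComplex.source_eq (C := C) c.1.1.1 c.2.1
      have h2 := RelCWComplex.source_eq (C := D) c.1.1.2 c.2.2
      simp only [CWProd.map, Equiv.transPartialEquiv_source, PartialEquiv.prod_source, h1, h2,
        mem_preimage, mem_prod, mem_ball_zero_iff]
      rw [← CWProd.norm_split c.1.2 v, Prod.norm_def, max_lt_iff]
      rfl)
    (continuousOn := fun n c => by
      have h1 := RelCWComplex.continuousOn (C := C) c.1.1.1 c.2.1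
      have h2 := RelCWComplex.continuousOn (C := D) c.1.1.2 c.2.2
      refine (h1.prodMap h2).comp (CWProd.split c.1.2).continuous.continuousOn ?_
      intro v hv
      rw [mem_closedBall_zero_iff, ← CWProd.norm_split c.1.2, Prod.norm_def, max_le_iff] at hv
      exact ⟨mem_closedBall_zero_iff.2 hv.1, mem_closedBall_zero_iff.2 hv.2⟩)
    (continuousOn_symm := fun n c => by
      have h1 := RelCWComplex.continuousOn_symm (C := C) c.1.1.1 c.2.1
      have h2 := RelCWComplex.continuousOn_symm (C := D) c.1.1.2 c.2.2
      exact (CWProd.split c.1.2).symm.continuous.comp_continuousOn (h1.prodMap h2))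
    (pairwiseDisjoint' := by
      rintro ⟨n, ⟨⟨k, l⟩, hn⟩, i, j⟩ - ⟨n', ⟨⟨k', l'⟩, hn'⟩, i', j'⟩ - hne
      simp only at hn hn' i j i' j'
      subst hn hn'
      simp only [Function.onFun, CWProd.image_ball]
      rw [Set.disjoint_prod]
      by_contra! hcon
      apply hne
      have e1 : (⟨k, i⟩ : Σ k, RelCWComplex.cell C k) = ⟨k', i'⟩ := by
        by_contra h
        exact hcon.1 (CWComplex.disjoint_openCell_of_ne h)
      have e2 : (⟨l, j⟩ : Σ k, RelCWComplex.cell D k) = ⟨l', j'⟩ := by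
        by_contra h
        exact hcon.2 (CWComplex.disjoint_openCell_of_ne h)
      cases e1
      cases e2
      rfl)
    (mapsTo_iff_image_subset := by
      rintro n ⟨⟨⟨k, l⟩, hn⟩, i, j⟩ v hv
      simp only at hn i j
      rw [mem_sphere_zero_iff_norm, ← CWProd.norm_split hn, Prod.norm_def] at hv
      have ha := (le_max_left _ _).trans_eq hv
      have hb := (le_max_right _ _).trans_eq hv
      simp only [mem_iUnion, CWProd.image_closedBall, exists_prop, CWProd.map_apply]
      rcases max_choice ‖(CWProd.split hn v).1‖ ‖(CWProd.split hn v).2‖ with h | h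
      · rw [h] at hv
        obtain ⟨I, hI⟩ := CWComplex.cellFrontier_subset_finite_closedCell (C := C) k i
        have := hI ⟨_, mem_sphere_zero_iff_norm.2 hv, rfl⟩
        simp only [mem_iUnion, exists_prop] at this
        obtain ⟨m, hm, i', -, hi'⟩ := this
        exact ⟨m + l, by omega, ⟨⟨⟨m, l⟩, rfl⟩, i', j⟩, hi',
          ⟨_, mem_closedBall_zero_iff.2 hb, rfl⟩⟩
      · rw [h] at hv
        obtain ⟨I, hI⟩ := CWComplex.cellFrontier_subset_finite_closedCell (C := D) l j
        have := hI ⟨_, mem_sphere_zero_iff_norm.2 hv, rfl⟩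
        simp only [mem_iUnion, exists_prop] at this
        obtain ⟨m, hm, j', -, hj'⟩ := this
        exact ⟨k + m, by omega, ⟨⟨⟨k, m⟩, rfl⟩, i, j'⟩,
          ⟨_, mem_closedBall_zero_iff.2 ha, rfl⟩, hj'⟩)
    (union' := by
      ext ⟨x, y⟩
      simp only [mem_iUnion, CWProd.image_closedBall]
      have hC : x ∈ C ↔ _ := Set.ext_iff.1 (CWComplex.union (C := C)).symm x
      have hD : y ∈ D ↔ _ := Set.ext_iff.1 (CWComplex.union (C := D)).symm y
      simp only [mem_iUnion] at hC hD
      constructor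
      · rintro ⟨n, ⟨⟨⟨k, l⟩, hn⟩, i, j⟩, hx, hy⟩
        exact ⟨hC.2 ⟨k, i, hx⟩, hD.2 ⟨l, j, hy⟩⟩
      · rintro ⟨hx, hy⟩
        obtain ⟨k, i, hx⟩ := hC.1 hx
        obtain ⟨l, j, hy⟩ := hD.1 hy
        exact ⟨k + l, ⟨⟨⟨k, l⟩, rfl⟩, i, j⟩, hx, hy⟩)

/-- The topological cellular complexity `TCC(C)` of a finite CW complex `C`: the least `n` such
that `C × C` is covered by `n` subcomplexes `Y_1, …, Y_n` of the product complex, each with a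
continuous section `Y_i → C^I` of the path fibration `γ ↦ (γ(0), γ(1))`, where `C^I` carries the
compact-open topology; it is `∞` if there is no such `n`. -/
noncomputable def cellularComplexity {X : Type*} [TopologicalSpace X] (C : Set X) [CWComplex C]
    [RelCWComplex.Finite C] : ℕ∞ :=
  ⨅ (n : ℕ) (_ : ∃ Y : Fin n → RelCWComplex.Subcomplex (C ×ˢ C),
      (⋃ i, (Y i : Set (X × X))) = C ×ˢ C ∧
      ∀ i, ∃ s : Y i → C(unitInterval, C), Continuous s ∧
        ∀ y : Y i, ((s y 0 : X), (s y 1 : X)) = (y : X × X)),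
    (n : ℕ∞)

/-! ### Geometric realization of a finite simplicial complex as a finite CW complex -/

namespace SimplicialRealization

/-- The closed simplex spanned by a set `s` of vertices, in barycentric coordinates. -/
def closedSimplex {V : Type*} (s : Finset V) : Set (V → ℝ) :=
  {x | (∀ v, 0 ≤ x v) ∧ (∀ v, v ∉ s → x v = 0) ∧ ∑ v ∈ s, x v = 1}

/-- The open simplex: all the barycentric coordinates at the vertices in `s` are positive. -/
def openSimplex {V : Type*} (s : Finset V) : Set (V → ℝ) :=
  {x | (∀ v ∈ s, 0 < x v) ∧ (∀ v, v ∉ s → x v = 0) ∧ ∑ v ∈ s, x v = 1}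

end SimplicialRealization

/-- The geometric realization of a simplicial complex, in barycentric coordinates (for finitely
many vertices the product topology of `V → ℝ` induces the usual topology). -/
def realization {V : Type*} (K : AbstractSimplicialComplex V) : Set (V → ℝ) :=
  ⋃ s ∈ K.faces, SimplicialRealization.closedSimplex s

namespace SimplicialRealization

/-- The open model simplex in `ℝⁿ`. -/
def model (n : ℕ) : Set (Fin n → ℝ) := {y | (∀ i, 0 < y i) ∧ ∑ i, y i < 1}

theorem isOpen_model (n : ℕ) : IsOpen (model n) := by
  have : model n = (⋂ i, {y : Fin n → ℝ | 0 < y i}) ∩ {y | ∑ i, y i < 1} := by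
    ext y; simp [model]
  rw [this]
  exact (isOpen_iInter_of_finite fun i => isOpen_lt continuous_const (continuous_apply i)).inter
    (isOpen_lt (by fun_prop) continuous_const)

theorem convex_model (n : ℕ) : Convex ℝ (model n) := by
  rintro x ⟨hx, hx'⟩ y ⟨hy, hy'⟩ a b ha hb hab
  refine ⟨fun i => ?_, ?_⟩
  · have h1 := hx i
    have h2 := hy i
    simp only [Pi.add_apply, Pi.smul_apply, smul_eq_mul]
    rcases ha.eq_or_lt with rfl | ha'
    · simp_all
    · nlinarith [mul_pos ha' h1, mul_nonneg hb h2.le]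
  · simp only [Pi.add_apply, Pi.smul_apply, smul_eq_mul, Finset.sum_add_distrib,
      ← Finset.mul_sum]
    rcases ha.eq_or_lt with rfl | ha'
    · simp_all
    · nlinarith [mul_lt_mul_of_pos_left hx' ha', mul_le_mul_of_nonneg_left hy'.le hb]

/-- The barycenter of the model simplex. -/
noncomputable def bary (n : ℕ) : Fin n → ℝ := fun _ => 1 / (n + 1 : ℝ)

theorem bary_mem (n : ℕ) : bary n ∈ model n := by
  refine ⟨fun i => by unfold bary; positivity, ?_⟩
  simp only [bary, Finset.sum_const, Finset.card_univ, Fintype.card_fin, nsmul_eq_mul]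
  rw [mul_one_div, div_lt_one (by positivity)]
  linarith

theorem closure_model (n : ℕ) :
    closure (model n) = {y | (∀ i, 0 ≤ y i) ∧ ∑ i, y i ≤ 1} := by
  apply Subset.antisymm
  · apply closure_minimal
    · rintro y ⟨h, h'⟩
      exact ⟨fun i => (h i).le, h'.le⟩
    · have : {y : Fin n → ℝ | (∀ i, 0 ≤ y i) ∧ ∑ i, y i ≤ 1} =
          (⋂ i, {y : Fin n → ℝ | 0 ≤ y i}) ∩ {y | ∑ i, y i ≤ 1} := by
        ext y; simp
      rw [this]
      exact (isClosed_iInter fun i => isClosed_le continuous_const (continuous_apply i)).inter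
        (isClosed_le (by fun_prop) continuous_const)
  · rintro y ⟨hy, hy'⟩
    obtain ⟨hb, hb'⟩ := bary_mem n
    have hseg : openSegment ℝ y (bary n) ⊆ model n := by
      rintro _ ⟨a, b, ha, hb0, hab, rfl⟩
      refine ⟨fun i => ?_, ?_⟩
      · simp only [Pi.add_apply, Pi.smul_apply, smul_eq_mul]
        have := mul_pos hb0 (hb i)
        have := mul_nonneg ha.le (hy i)
        linarith
      · simp only [Pi.add_apply, Pi.smul_apply, smul_eq_mul, Finset.sum_add_distrib,
          ← Finset.mul_sum]
        nlinarith [mul_lt_mul_of_pos_left hb' hb0, mul_le_mul_of_nonneg_left hy' ha.le]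
    have h := segment_subset_closure_openSegment (𝕜 := ℝ) (x := y) (y := bary n)
      (left_mem_segment ℝ y (bary n))
    exact closure_mono hseg h

theorem isBounded_model (n : ℕ) : Bornology.IsBounded (model n) := by
  refine (isBounded_closedBall (x := (0 : Fin n → ℝ)) (r := 1)).subset ?_
  rintro y ⟨h, h'⟩
  rw [mem_closedBall_zero_iff, pi_norm_le_iff_of_nonneg zero_le_one]
  intro i
  rw [Real.norm_of_nonneg (h i).le]
  exact (Finset.single_le_sum (fun j _ => (h j).le) (Finset.mem_univ i)).trans h'.le

theorem exists_homeo (n : ℕ) : ∃ h : (Fin n → ℝ) ≃ₜ (Fin n → ℝ),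
    h '' model n = ball 0 1 ∧ h '' closure (model n) = closedBall 0 1 := by
  obtain ⟨h, h1, h2, -⟩ := exists_homeomorph_image_interior_closure_frontier_eq_unitBall
    (convex_model n) (by rw [(isOpen_model n).interior_eq]; exact ⟨_, bary_mem n⟩)
    (isBounded_model n)
  rw [(isOpen_model n).interior_eq] at h1
  exact ⟨h, h1, h2⟩

/-- A homeomorphism of `ℝⁿ` that carries the model simplex to the unit ball. -/
noncomputable def homeo (n : ℕ) : (Fin n → ℝ) ≃ₜ (Fin n → ℝ) := (exists_homeo n).choose

theorem homeo_mem_ball {n : ℕ} {y : Fin n → ℝ} : homeo n y ∈ ball 0 1 ↔ y ∈ model n := by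
  have h : homeo n '' model n = ball 0 1 := (exists_homeo n).choose_spec.1
  rw [← h, (homeo n).injective.mem_set_image]

theorem homeo_mem_closedBall {n : ℕ} {y : Fin n → ℝ} :
    homeo n y ∈ closedBall 0 1 ↔ (∀ i, 0 ≤ y i) ∧ ∑ i, y i ≤ 1 := by
  have h : homeo n '' closure (model n) = closedBall 0 1 := (exists_homeo n).choose_spec.2
  rw [← h, (homeo n).injective.mem_set_image, closure_model]
  rfl

/-- An enumeration of the vertices of an `n`-simplex. -/
noncomputable def enum {V : Type*} {n : ℕ} {s : Finset V} (hs : s.card = n + 1) :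
    Fin (n + 1) ≃ s :=
  (s.equivFinOfCardEq hs).symm

open Classical in
/-- The affine map from `ℝⁿ` onto the affine hull of the simplex `s`. -/
noncomputable def affine {V : Type*} {n : ℕ} {s : Finset V} (hs : s.card = n + 1)
    (y : Fin n → ℝ) : V → ℝ := fun v =>
  if h : v ∈ s then
    (Fin.cons (1 - ∑ i, y i) y : Fin (n + 1) → ℝ) ((enum hs).symm ⟨v, h⟩) else 0

theorem affine_enum {V : Type*} {n : ℕ} {s : Finset V} (hs : s.card = n + 1) (y : Fin n → ℝ)
    (i : Fin (n + 1)) :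
    affine hs y (enum hs i) = (Fin.cons (1 - ∑ i, y i) y : Fin (n + 1) → ℝ) i := by
  simp [affine]

theorem affine_notMem {V : Type*} {n : ℕ} {s : Finset V} (hs : s.card = n + 1) (y : Fin n → ℝ)
    {v : V} (hv : v ∉ s) : affine hs y v = 0 := by
  simp [affine, hv]

/-- The affine coordinates on a simplex. -/
noncomputable def coords {V : Type*} {n : ℕ} {s : Finset V} (hs : s.card = n + 1)
    (x : V → ℝ) : Fin n → ℝ := fun i => x (enum hs i.succ)

theorem coords_affine {V : Type*} {n : ℕ} {s : Finset V} (hs : s.card = n + 1)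
    (y : Fin n → ℝ) : coords hs (affine hs y) = y := by
  ext i
  simp [coords, affine_enum]

theorem sum_eq {V : Type*} {n : ℕ} {s : Finset V} (hs : s.card = n + 1) (x : V → ℝ) :
    ∑ v ∈ s, x v = x (enum hs 0) + ∑ i, coords hs x i := by
  rw [← Finset.sum_coe_sort, ← (enum hs).sum_comp, Fin.sum_univ_succ]
  rfl

theorem affine_coords {V : Type*} {n : ℕ} {s : Finset V} (hs : s.card = n + 1) {x : V → ℝ}
    (h0 : ∀ v, v ∉ s → x v = 0) (h1 : ∑ v ∈ s, x v = 1) : affine hs (coords hs x) = x := by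
  ext v
  by_cases hv : v ∈ s
  · obtain ⟨i, hi⟩ := (enum hs).surjective ⟨v, hv⟩
    have hv' : v = enum hs i := by rw [hi]
    rw [hv', affine_enum]
    rw [sum_eq hs] at h1
    induction i using Fin.cases with
    | zero => simp; linarith
    | succ i => simp [coords]
  · rw [affine_notMem hs _ hv, h0 v hv]

theorem sum_affine {V : Type*} {n : ℕ} {s : Finset V} (hs : s.card = n + 1)
    (y : Fin n → ℝ) : ∑ v ∈ s, affine hs y v = 1 := by
  rw [sum_eq hs, coords_affine, affine_enum]
  simp

theorem affine_mem_openSimplex {V : Type*} {n : ℕ} {s : Finset V} (hs : s.card = n + 1)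
    {y : Fin n → ℝ} : affine hs y ∈ openSimplex s ↔ y ∈ model n := by
  constructor
  · rintro ⟨h, -, -⟩
    refine ⟨fun i => ?_, ?_⟩
    · simpa [affine_enum] using h _ (enum hs i.succ).2
    · simpa [affine_enum] using h _ (enum hs 0).2
  · rintro ⟨h, h'⟩
    refine ⟨fun v hv => ?_, fun v hv => affine_notMem hs y hv, sum_affine hs y⟩
    obtain ⟨i, hi⟩ := (enum hs).surjective ⟨v, hv⟩
    have hv' : v = enum hs i := by rw [hi]
    rw [hv', affine_enum]
    induction i using Fin.cases with
    | zero => simpa using h'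
    | succ i => simpa using h i

theorem affine_mem_closedSimplex {V : Type*} {n : ℕ} {s : Finset V} (hs : s.card = n + 1)
    {y : Fin n → ℝ} :
    affine hs y ∈ closedSimplex s ↔ (∀ i, 0 ≤ y i) ∧ ∑ i, y i ≤ 1 := by
  constructor
  · rintro ⟨h, -, -⟩
    refine ⟨fun i => ?_, ?_⟩
    · simpa [affine_enum] using h (enum hs i.succ)
    · simpa [affine_enum] using h (enum hs 0)
  · rintro ⟨h, h'⟩
    refine ⟨fun v => ?_, fun v hv => affine_notMem hs y hv, sum_affine hs y⟩
    by_cases hv : v ∈ s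
    · obtain ⟨i, hi⟩ := (enum hs).surjective ⟨v, hv⟩
      have hv' : v = enum hs i := by rw [hi]
      rw [hv', affine_enum]
      induction i using Fin.cases with
      | zero => simpa using h'
      | succ i => simpa using h i
    · rw [affine_notMem hs y hv]

theorem continuous_affine {V : Type*} {n : ℕ} {s : Finset V} (hs : s.card = n + 1) :
    Continuous (affine hs) := by
  refine continuous_pi fun v => ?_
  by_cases hv : v ∈ s
  · obtain ⟨i, hi⟩ := (enum hs).surjective ⟨v, hv⟩
    have hv' : v = enum hs i := by rw [hi]
    rw [hv']
    simp only [affine_enum]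
    induction i using Fin.cases with
    | zero => simp only [Fin.cons_zero]; fun_prop
    | succ i => simp only [Fin.cons_succ]; fun_prop
  · simp only [affine_notMem hs _ hv]
    exact continuous_const

/-- The `n`-simplices of a simplicial complex. -/
abbrev Cell {V : Type*} (K : AbstractSimplicialComplex V) (n : ℕ) : Type _ :=
  {s : Finset V // s ∈ K.faces ∧ s.card = n + 1}

/-- The characteristic map of an `n`-simplex. -/
noncomputable def map {V : Type*} {K : AbstractSimplicialComplex V} (n : ℕ) (s : Cell K n) :
    PartialEquiv (Fin n → ℝ) (V → ℝ) where
  toFun v := affine s.2.2 ((homeo n).symm v)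
  invFun x := homeo n (coords s.2.2 x)
  source := ball 0 1
  target := openSimplex s.1
  map_source' v hv := by
    rw [affine_mem_openSimplex, ← homeo_mem_ball, Homeomorph.apply_symm_apply]
    exact hv
  map_target' x hx := by
    rw [homeo_mem_ball, ← affine_mem_openSimplex s.2.2, affine_coords s.2.2 hx.2.1 hx.2.2]
    exact hx
  left_inv' v hv := by
    rw [coords_affine, Homeomorph.apply_symm_apply]
  right_inv' x hx := by
    rw [Homeomorph.symm_apply_apply, affine_coords s.2.2 hx.2.1 hx.2.2]

theorem image_ball {V : Type*} {K : AbstractSimplicialComplex V} (n : ℕ) (s : Cell K n) :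
    map n s '' ball 0 1 = openSimplex s.1 :=
  (map n s).image_source_eq_target

theorem image_closedBall {V : Type*} {K : AbstractSimplicialComplex V} (n : ℕ) (s : Cell K n) :
    map n s '' closedBall 0 1 = closedSimplex s.1 := by
  ext x
  constructor
  · rintro ⟨v, hv, rfl⟩
    change affine s.2.2 ((homeo n).symm v) ∈ _
    rw [affine_mem_closedSimplex, ← homeo_mem_closedBall, Homeomorph.apply_symm_apply]
    exact hv
  · intro hx
    refine ⟨homeo n (coords s.2.2 x), ?_, ?_⟩
    · rw [homeo_mem_closedBall, ← affine_mem_closedSimplex s.2.2,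
        affine_coords s.2.2 hx.2.1 hx.2.2]
      exact hx
    · change affine s.2.2 ((homeo n).symm _) = _
      rw [Homeomorph.symm_apply_apply, affine_coords s.2.2 hx.2.1 hx.2.2]

theorem eq_of_mem_openSimplex {V : Type*} {s t : Finset V} {x : V → ℝ} (hs : x ∈ openSimplex s)
    (ht : x ∈ openSimplex t) : s = t := by
  ext v
  constructor
  · intro hv
    by_contra h
    exact (hs.1 v hv).ne' (ht.2.1 v h)
  · intro hv
    by_contra h
    exact (ht.1 v hv).ne' (hs.2.1 v h)

theorem eventually_isEmpty_cell {V : Type*} [Finite V] (K : AbstractSimplicialComplex V) :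
    ∀ᶠ n in Filter.atTop, IsEmpty (Cell K n) := by
  have := Fintype.ofFinite V
  refine Filter.eventually_atTop.2 ⟨Fintype.card V, fun n hn => ⟨fun s => ?_⟩⟩
  have h1 := s.2.2
  have h2 := s.1.card_le_univ
  omega

theorem finite_cell {V : Type*} [Finite V] (K : AbstractSimplicialComplex V) (n : ℕ) :
    Finite (Cell K n) := by
  infer_instance

theorem mapsTo_sphere {V : Type*} {K : AbstractSimplicialComplex V} (n : ℕ) (s : Cell K n) :
    MapsTo (map n s) (sphere 0 1)
      (⋃ (m < n) (t : Cell K m), map m t '' closedBall 0 1) := by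
  classical
  intro v hv
  have h1 : map n s v ∈ closedSimplex s.1 := by
    rw [← image_closedBall]
    exact ⟨v, sphere_subset_closedBall hv, rfl⟩
  have h2 : map n s v ∉ openSimplex s.1 := by
    intro h
    change affine s.2.2 ((homeo n).symm v) ∈ _ at h
    rw [affine_mem_openSimplex, ← homeo_mem_ball, Homeomorph.apply_symm_apply] at h
    rw [mem_ball_zero_iff] at h
    rw [mem_sphere_zero_iff_norm] at hv
    exact h.ne hv
  generalize map n s v = x at h1 h2
  obtain ⟨hx0, hx1, hx2⟩ := h1
  obtain ⟨w, hw, hxw⟩ : ∃ w ∈ s.1, x w = 0 := by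
    by_contra! hcon
    exact h2 ⟨fun w hw => (hx0 w).lt_of_ne' (hcon w hw), hx1, hx2⟩
  have hsum : ∑ v ∈ s.1.erase w, x v = 1 := by
    rw [← hx2, ← Finset.add_sum_erase _ _ hw, hxw, zero_add]
  have hcard : (s.1.erase w).card = n := by
    rw [Finset.card_erase_of_mem hw, s.2.2]
    rfl
  have hne : (s.1.erase w).Nonempty := by
    by_contra h
    rw [Finset.not_nonempty_iff_eq_empty] at h
    rw [h] at hsum
    simp at hsum
  have hn : 0 < n := by
    rw [← hcard]
    exact hne.card_pos
  simp only [mem_iUnion, exists_prop]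
  let t : Cell K (n - 1) := ⟨s.1.erase w,
    (K.isRelLowerSet_faces s.2.1).2 (Finset.erase_subset _ _) hne, by omega⟩
  refine ⟨n - 1, by omega, t, ?_⟩
  rw [image_closedBall]
  refine ⟨hx0, fun v hv => ?_, hsum⟩
  by_cases hvw : v = w
  · rw [hvw, hxw]
  · exact hx1 v fun h => hv (Finset.mem_erase.2 ⟨hvw, h⟩)

theorem iUnion_eq {V : Type*} (K : AbstractSimplicialComplex V) :
    ⋃ (n : ℕ) (s : Cell K n), map n s '' closedBall 0 1 = realization K := by
  ext x
  simp only [mem_iUnion, image_closedBall, realization, exists_prop]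
  constructor
  · rintro ⟨n, s, hx⟩
    exact ⟨s.1, s.2.1, hx⟩
  · rintro ⟨s, hs, hx⟩
    have := (K.isRelLowerSet_faces hs).1.card_pos
    exact ⟨s.card - 1, ⟨s, hs, by omega⟩, hx⟩

end SimplicialRealization

open SimplicialRealization in
/-- The realization of a simplicial complex with finitely many vertices is a CW complex whose
cells are the simplices. -/
noncomputable instance realization.instCWComplex {V : Type*} [Finite V]
    (K : AbstractSimplicialComplex V) : CWComplex (realization K) :=
  CWComplex.mkFinite (realization K)
    (cell := Cell K)
    (map := map)
    (eventually_isEmpty_cell := eventually_isEmpty_cell K)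
    (finite_cell := finite_cell K)
    (source_eq := fun _ _ => rfl)
    (continuousOn := fun n s =>
      ((continuous_affine s.2.2).comp (homeo n).symm.continuous).continuousOn)
    (continuousOn_symm := fun n s =>
      ((homeo n).continuous.comp
        (continuous_pi fun i => continuous_apply (enum s.2.2 i.succ : V))).continuousOn)
    (pairwiseDisjoint' := by
      rintro ⟨n, s⟩ - ⟨n', s'⟩ - hne
      simp only [Function.onFun, image_ball]
      refine Set.disjoint_left.2 fun x hx hx' => hne ?_
      obtain ⟨s, hs, hn⟩ := s
      obtain ⟨s', hs', hn'⟩ := s'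
      obtain rfl := eq_of_mem_openSimplex hx hx'
      obtain rfl : n = n' := Nat.succ_injective (hn.symm.trans hn')
      rfl)
    (mapsTo_iff_image_subset := mapsTo_sphere)
    (union' := iUnion_eq K)

instance realization.instFinite {V : Type*} [Finite V] (K : AbstractSimplicialComplex V) :
    RelCWComplex.Finite (realization K) :=
  CWComplex.finite_mkFinite _ _ _ _ _ _ _ _ _ _ _

/-! ### The order complex -/

/-- The order complex `𝒦(P)`: its simplices are the finite nonempty chains of `P`. -/
def orderComplex (P : Type*) [PartialOrder P] : AbstractSimplicialComplex P where
  faces := {s | s.Nonempty ∧ IsChain (· ≤ ·) (s : Set P)}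
  isRelLowerSet_faces := fun _ hs =>
    ⟨hs.1, fun _ hts ht => ⟨ht, hs.2.mono (Finset.coe_subset.2 hts)⟩⟩
  singleton_mem := fun v => ⟨Finset.singleton_nonempty v, by simp⟩

/-! A point `x` of the order complex is a probability weight on a chain of `P`. Laying the weights
end to end along the chain turns it into a nondecreasing step function `[0, 1) → P`, and the lengths
of its level sets recover `x`. A pair `(x, y)` thus becomes a nondecreasing step function into `P ×
P`. Composing it with a map `f` that is monotone on a set `Q` containing all its values gives
another such function, whose distribution is again a point of the order complex (`pushforward_mem`).
This yields a continuous map out of the union of the products of simplices with vertices in `Q`,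
without triangulating those products.

If `f ≤ g` on `Q`, using `f` on `[0, r)` and `g` on `[r, 1)` still gives a nondecreasing function.
Moving `r` from `1` to `0` is therefore a homotopy between the induced maps
(`inducedMap_homotopic`).

A continuous section `Q → P^{J_m}` is a sequence of monotone maps `Q → P`, consecutive ones
comparable, running from the first projection to the second. Hence the two projections are homotopic
on the subcomplex attached to `Q`, and currying the homotopy gives a section of the path fibration
(`exists_section_of_homotopic`). These subcomplexes cover because open sets are lower sets: the pair
of top vertices of a product of two simplices lies in some `Q i`, and then so do all its other pairs
of vertices (`iUnion_supportedOn`). -/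

namespace SimplicialRealization

open MeasureTheory in
/-- The length of the overlap of the intervals `[a, b)` and `[c, d)`. -/
theorem volume_real_Ico_inter_Ico (a b c d : ℝ) :
    volume.real (Ico a b ∩ Ico c d) = max 0 (min b d - max a c) := by
  rw [Ico_inter_Ico, Real.volume_real_Ico, max_comm]

/-- The simplex containing `x` can be taken to be its support, so membership becomes a condition on
`x` alone. -/
theorem mem_realization_orderComplex {P : Type*} [PartialOrder P] [Fintype P] {x : P → ℝ} :
    x ∈ realization (orderComplex P) ↔
      (∀ v, 0 ≤ x v) ∧ IsChain (· ≤ ·) {v | x v ≠ 0} ∧ ∑ v, x v = 1 := by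
  classical
  simp only [realization, mem_iUnion, exists_prop]
  constructor
  · rintro ⟨s, hs, h0, h1, h2⟩
    refine ⟨h0, hs.2.mono fun v hv => ?_, ?_⟩
    · by_contra h
      exact hv (h1 v h)
    · rw [← h2]
      exact (Finset.sum_subset (Finset.subset_univ s) fun v _ hv => h1 v hv).symm
  · rintro ⟨h0, h1, h2⟩
    have h3 : ∑ v ∈ Finset.univ.filter (fun v => x v ≠ 0), x v = 1 := by
      rw [Finset.sum_filter_ne_zero, h2]
    refine ⟨Finset.univ.filter (fun v => x v ≠ 0), ⟨?_, by simpa using h1⟩, h0, by simp, h3⟩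
    rw [Finset.nonempty_iff_ne_empty]
    intro h
    rw [h] at h3
    simp at h3

/-! ### Points of the order complex as nondecreasing step functions. -/

section StepFunction

variable {P : Type*} [PartialOrder P] [Fintype P]

open Classical in
/-- The total weight of a point strictly below a vertex. -/
noncomputable def weightBelow (x : P → ℝ) (a : P) : ℝ := ∑ p with p < a, x p

/-- A point of the order complex as a step function on `[0, 1)`: this is the interval
on which the value is the vertex `a`. -/
def stepInterval (x : P → ℝ) (a : P) : Set ℝ :=
  Ico (weightBelow x a) (weightBelow x a + x a)

theorem ne_zero_of_mem_stepInterval {x : P → ℝ} {a : P} {u : ℝ} (h : u ∈ stepInterval x a) :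
    x a ≠ 0 := by
  intro h0
  rw [stepInterval, h0, add_zero, Ico_self] at h
  exact h

open Classical in
theorem weightBelow_add (x : P → ℝ) (a : P) : weightBelow x a + x a = ∑ p with p ≤ a, x p := by
  have : (Finset.univ.filter fun p : P => p ≤ a) =
      insert a (Finset.univ.filter fun p : P => p < a) := by
    ext p
    simp [le_iff_eq_or_lt]
  rw [this, Finset.sum_insert (by simp), add_comm, weightBelow]

variable {x : P → ℝ} (hx : x ∈ realization (orderComplex P))

include hx

theorem weightBelow_nonneg (a : P) : 0 ≤ weightBelow x a :=
  Finset.sum_nonneg fun p _ => (mem_realization_orderComplex.1 hx).1 p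

theorem weightBelow_add_le_one (a : P) : weightBelow x a + x a ≤ 1 := by
  classical
  rw [weightBelow_add, ← (mem_realization_orderComplex.1 hx).2.2]
  exact Finset.sum_le_sum_of_subset_of_nonneg (Finset.subset_univ _)
    fun p _ _ => (mem_realization_orderComplex.1 hx).1 p

theorem stepInterval_subset (a : P) : stepInterval x a ⊆ Ico 0 1 :=
  Ico_subset_Ico (weightBelow_nonneg hx a) (weightBelow_add_le_one hx a)

theorem weightBelow_add_le_of_lt {a b : P} (h : a < b) :
    weightBelow x a + x a ≤ weightBelow x b := by
  classical
  rw [weightBelow_add]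
  refine Finset.sum_le_sum_of_subset_of_nonneg (fun p hp => ?_)
    fun p _ _ => (mem_realization_orderComplex.1 hx).1 p
  simp only [Finset.mem_filter, Finset.mem_univ, true_and] at hp ⊢
  exact hp.trans_lt h

/-- This is monotonicity of the step function: the support is a chain, and if `b < a` the whole
interval of `b` would end before that of `a` begins. -/
theorem le_of_mem_stepInterval {a b : P} {u v : ℝ} (hu : u ∈ stepInterval x a)
    (hv : v ∈ stepInterval x b) (h : u ≤ v) : a ≤ b := by
  rcases (mem_realization_orderComplex.1 hx).2.1.total (ne_zero_of_mem_stepInterval hu)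
    (ne_zero_of_mem_stepInterval hv) with hab | hab
  · exact hab
  · rcases hab.eq_or_lt with rfl | hlt
    · exact le_rfl
    · have := weightBelow_add_le_of_lt hx hlt
      have h1 := hu.1
      have h2 := hv.2
      linarith

theorem pairwise_disjoint_stepInterval :
    Pairwise (Function.onFun Disjoint (stepInterval x)) := fun _ _ hab =>
  Set.disjoint_left.2 fun _ ha hb =>
    hab ((le_of_mem_stepInterval hx ha hb le_rfl).antisymm (le_of_mem_stepInterval hx hb ha le_rfl))

/-- Along the chain of vertices of nonzero weight, each interval starts where the previous one ends.
The induction `key` climbs this chain until it meets the interval containing `u`. -/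
theorem iUnion_stepInterval : ⋃ a, stepInterval x a = Ico 0 1 := by
  classical
  refine (iUnion_subset (stepInterval_subset hx)).antisymm fun u hu => ?_
  obtain ⟨h0, hc, h1⟩ := mem_realization_orderComplex.1 hx
  have key : ∀ b : P, x b ≠ 0 → weightBelow x b ≤ u ∨ ∃ a, u ∈ stepInterval x a := by
    intro b
    induction b using WellFoundedLT.induction with
    | _ b ih =>
      intro hb
      by_cases hlt : ∃ p, p < b ∧ x p ≠ 0
      -- `c` is the predecessor of `b` in the support, so `weightBelow x b` is at most the right end
      -- of the interval of `c`.
      · obtain ⟨c, -, hcm⟩ := (Set.toFinite {p | p < b ∧ x p ≠ 0}).exists_le_maximal hlt.choose_spec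
        rcases ih c hcm.prop.1 hcm.prop.2 with h | h
        · by_cases hu' : u < weightBelow x c + x c
          · exact Or.inr ⟨c, h, hu'⟩
          · left
            refine le_trans ?_ (not_lt.1 hu')
            rw [weightBelow_add, weightBelow]
            rw [← Finset.sum_filter_ne_zero]
            refine Finset.sum_le_sum_of_subset_of_nonneg (fun p hp => ?_) fun p _ _ => h0 p
            simp only [Finset.mem_filter, Finset.mem_univ, true_and] at hp ⊢
            rcases hc.total hp.2 hcm.prop.2 with h' | h'
            · exact h'
            · exact hcm.le_of_ge hp h'
        · exact Or.inr h
      · left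
        push Not at hlt
        rw [weightBelow, Finset.sum_eq_zero]
        · exact hu.1
        · intro p hp
          exact hlt p (by simpa using hp)
  have hne : {p | x p ≠ 0}.Nonempty := by
    by_contra h
    rw [Set.not_nonempty_iff_eq_empty] at h
    rw [Finset.sum_eq_zero] at h1
    · exact zero_ne_one h1
    · intro p _
      by_contra hp
      exact (h ▸ hp : p ∈ (∅ : Set P))
  -- `c` is the top vertex of the support; its interval ends at `1`.
  obtain ⟨c, -, hcm⟩ := (Set.toFinite {p | x p ≠ 0}).exists_le_maximal hne.choose_spec
  rw [mem_iUnion]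
  rcases key c hcm.prop with h | h
  · refine ⟨c, h, ?_⟩
    refine hu.2.trans_le ?_
    rw [weightBelow_add, ← h1, ← Finset.sum_filter_ne_zero]
    refine Finset.sum_le_sum_of_subset_of_nonneg (fun p hp => ?_) fun p _ _ => h0 p
    simp only [Finset.mem_filter, Finset.mem_univ, true_and] at hp ⊢
    rcases hc.total hp hcm.prop with h' | h'
    · exact h'
    · exact hcm.le_of_ge hp h'
  · exact h

open MeasureTheory in
theorem sum_volume_real_inter_stepInterval {s : Set ℝ} (hs : s ⊆ Ico 0 1)
    (hm : MeasurableSet s) :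
    ∑ a, volume.real (s ∩ stepInterval x a) = volume.real s := by
  have hfin : volume s ≠ ⊤ := ((measure_mono hs).trans_lt (by simp)).ne
  rw [← measureReal_iUnion_fintype, ← inter_iUnion, iUnion_stepInterval hx, inter_eq_left.2 hs]
  · exact fun a b hab => (pairwise_disjoint_stepInterval hx hab).mono inter_subset_right
      inter_subset_right
  · exact fun a => hm.inter measurableSet_Ico

end StepFunction

/-! ### Joint distribution of two step functions. -/

section Overlap

open MeasureTheory

variable {P : Type*} [PartialOrder P] [Fintype P]

/-- The length of the part of `[l, r)` on which the pair of step functions given by `x` and `y`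
takes the value `z`. -/
noncomputable def overlap (x y : P → ℝ) (l r : ℝ) (z : P × P) : ℝ :=
  max 0 (min r (min (weightBelow x z.1 + x z.1) (weightBelow y z.2 + y z.2)) -
    max l (max (weightBelow x z.1) (weightBelow y z.2)))

/-- The formula with `max` and `min` makes continuity visible, across different simplices as well;
the form as a measure makes sums computable by additivity. -/
theorem overlap_eq (x y : P → ℝ) (l r : ℝ) (z : P × P) :
    overlap x y l r z = volume.real (Ico l r ∩ (stepInterval x z.1 ∩ stepInterval y z.2)) := by
  rw [stepInterval, stepInterval, Ico_inter_Ico, volume_real_Ico_inter_Ico]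
  rfl

theorem overlap_nonneg (x y : P → ℝ) (l r : ℝ) (z : P × P) : 0 ≤ overlap x y l r z :=
  le_max_left _ _

theorem overlap_self (x y : P → ℝ) (l : ℝ) (z : P × P) : overlap x y l l z = 0 := by
  simp [overlap_eq]

theorem exists_mem_of_overlap_ne_zero {x y : P → ℝ} {l r : ℝ} {z : P × P}
    (h : overlap x y l r z ≠ 0) :
    ∃ u ∈ Ico l r, u ∈ stepInterval x z.1 ∧ u ∈ stepInterval y z.2 := by
  rw [overlap_eq] at h
  obtain ⟨u, hu⟩ := nonempty_of_measureReal_ne_zero h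
  exact ⟨u, hu⟩

theorem continuous_overlap {T : Type*} [TopologicalSpace T] {x y : T → P → ℝ} {l r : T → ℝ}
    (hx : Continuous x) (hy : Continuous y) (hl : Continuous l) (hr : Continuous r) (z : P × P) :
    Continuous fun t => overlap (x t) (y t) (l t) (r t) z := by
  unfold overlap weightBelow
  fun_prop

variable {x y : P → ℝ} (hx : x ∈ realization (orderComplex P))
  (hy : y ∈ realization (orderComplex P))

include hy in
theorem sum_overlap_snd (l r : ℝ) (a : P) (h : stepInterval x a ⊆ Ico 0 1) :
    ∑ b, overlap x y l r (a, b) = volume.real (Ico l r ∩ stepInterval x a) := by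
  rw [← sum_volume_real_inter_stepInterval hy (inter_subset_right.trans h)
    (measurableSet_Ico.inter measurableSet_Ico)]
  simp only [overlap_eq, inter_assoc]

theorem overlap_swap (l r : ℝ) (z : P × P) : overlap x y l r z = overlap y x l r z.swap := by
  rw [overlap_eq, overlap_eq, inter_comm (stepInterval x z.1)]
  rfl

include hx hy in
theorem sum_overlap {l r : ℝ} (hl : 0 ≤ l) (hr : r ≤ 1) (hlr : l ≤ r) :
    ∑ z, overlap x y l r z = r - l := by
  rw [Fintype.sum_prod_type]
  simp only [sum_overlap_snd hy _ _ _ (stepInterval_subset hx _)]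
  rw [sum_volume_real_inter_stepInterval hx (Ico_subset_Ico hl hr) measurableSet_Ico,
    Real.volume_real_Ico, max_eq_left (by linarith)]

-- The joint distribution over all of `[0, 1)` has marginals `x` and, by the swapped statement, `y`.
include hx hy in
theorem sum_overlap_snd_zero_one (a : P) : ∑ b, overlap x y 0 1 (a, b) = x a := by
  have h := stepInterval_subset hx a
  rw [sum_overlap_snd hy _ _ _ h, inter_eq_right.2 h, stepInterval, Real.volume_real_Ico,
    add_sub_cancel_left, max_eq_left ((mem_realization_orderComplex.1 hx).1 a)]

include hx hy in
theorem sum_overlap_fst_zero_one (b : P) : ∑ a, overlap x y 0 1 (a, b) = y b := by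
  simp only [overlap_swap (x := x), Prod.swap_prod_mk]
  exact sum_overlap_snd_zero_one hy hx b

end Overlap

/-! ### Pushing a pair of points forward along monotone maps. -/

section Pushforward

variable {P : Type*} [PartialOrder P] [Fintype P]

open Classical in
/-- The distribution of the values of the step function which is the composite of `f` with the
pair of step functions `x, y` on `[0, r)`, and the composite with `g` on `[r, 1)`. -/
noncomputable def pushforward (f g : P × P → P) (x y : P → ℝ) (r : ℝ) (v : P) : ℝ :=
  (∑ z with f z = v, overlap x y 0 r z) + ∑ z with g z = v, overlap x y r 1 z

/-- At `r = 1` the part governed by `g` is empty, and at `r = 0` the part governed by `f` is; these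
are the two ends of the homotopy. -/
theorem pushforward_one (f g : P × P → P) (x y : P → ℝ) :
    pushforward f g x y 1 = pushforward f f x y 1 := by
  ext v
  simp [pushforward, overlap_self]

theorem pushforward_zero (f g : P × P → P) (x y : P → ℝ) :
    pushforward f g x y 0 = pushforward g g x y 1 := by
  ext v
  simp [pushforward, overlap_self]

theorem continuous_pushforward {T : Type*} [TopologicalSpace T] (f g : P × P → P)
    {x y : T → P → ℝ} {r : T → ℝ} (hx : Continuous x) (hy : Continuous y) (hr : Continuous r) :
    Continuous fun t => pushforward f g (x t) (y t) (r t) :=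
  continuous_pi fun _ =>
    (continuous_finsetSum _ fun z _ => continuous_overlap hx hy continuous_const hr z).add
      (continuous_finsetSum _ fun z _ => continuous_overlap hx hy hr continuous_const z)

variable {x y : P → ℝ} (hx : x ∈ realization (orderComplex P))
  (hy : y ∈ realization (orderComplex P))

include hx hy

theorem pushforward_fst : pushforward Prod.fst Prod.fst x y 1 = x := by
  classical
  ext v
  simp only [pushforward, overlap_self, Finset.sum_const_zero, add_zero]
  rw [← sum_overlap_snd_zero_one hx hy v, Finset.sum_filter, Fintype.sum_prod_type_right]
  simp

theorem pushforward_snd : pushforward Prod.snd Prod.snd x y 1 = y := by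
  classical
  ext v
  simp only [pushforward, overlap_self, Finset.sum_const_zero, add_zero]
  rw [← sum_overlap_fst_zero_one hx hy v, Finset.sum_filter, Fintype.sum_prod_type]
  simp

/-- The values of the composite form a chain because the composite is nondecreasing: each half is
monotone, and at the switch from `f` to `g` the value can only go up since `f ≤ g`. The total weight
is `r + (1 - r)`. -/
theorem pushforward_mem {Q : Set (P × P)} (hQ : ∀ a b, x a ≠ 0 → y b ≠ 0 → (a, b) ∈ Q)
    {f g : P × P → P} (hf : MonotoneOn f Q) (hg : MonotoneOn g Q) (hfg : ∀ z ∈ Q, f z ≤ g z)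
    {r : ℝ} (h0 : 0 ≤ r) (h1 : r ≤ 1) :
    pushforward f g x y r ∈ realization (orderComplex P) := by
  classical
  have hstep : ∀ {l r : ℝ} {z : P × P}, overlap x y l r z ≠ 0 →
      z ∈ Q ∧ ∃ u ∈ Ico l r, u ∈ stepInterval x z.1 ∧ u ∈ stepInterval y z.2 := by
    intro l r z h
    obtain ⟨u, hu, hux, huy⟩ := exists_mem_of_overlap_ne_zero h
    exact ⟨hQ _ _ (ne_zero_of_mem_stepInterval hux) (ne_zero_of_mem_stepInterval huy),
      u, hu, hux, huy⟩
  have hle : ∀ {z w : P × P} {u v : ℝ}, u ∈ stepInterval x z.1 → u ∈ stepInterval y z.2 →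
      v ∈ stepInterval x w.1 → v ∈ stepInterval y w.2 → u ≤ v → z ≤ w :=
    fun h1 h2 h3 h4 h => ⟨le_of_mem_stepInterval hx h1 h3 h, le_of_mem_stepInterval hy h2 h4 h⟩
  have hsupp : ∀ {v}, pushforward f g x y r v ≠ 0 →
      (∃ z, f z = v ∧ overlap x y 0 r z ≠ 0) ∨ ∃ z, g z = v ∧ overlap x y r 1 z ≠ 0 := by
    intro v hv
    by_contra! h
    apply hv
    rw [pushforward, Finset.sum_eq_zero, Finset.sum_eq_zero, add_zero]
    · exact fun z hz => h.2 z (by simpa using hz)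
    · exact fun z hz => h.1 z (by simpa using hz)
  refine mem_realization_orderComplex.2 ⟨fun v => ?_, ?_, ?_⟩
  · exact add_nonneg (Finset.sum_nonneg fun z _ => overlap_nonneg ..)
      (Finset.sum_nonneg fun z _ => overlap_nonneg ..)
  · rintro v hv w hw -
    rcases hsupp hv with ⟨z, rfl, hz⟩ | ⟨z, rfl, hz⟩ <;>
    rcases hsupp hw with ⟨z', rfl, hz'⟩ | ⟨z', rfl, hz'⟩ <;>
    obtain ⟨hzQ, u, hu, hux, huy⟩ := hstep hz <;>
    obtain ⟨hzQ', u', hu', hux', huy'⟩ := hstep hz'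
    · rcases le_total u u' with h | h
      · exact Or.inl (hf hzQ hzQ' (hle hux huy hux' huy' h))
      · exact Or.inr (hf hzQ' hzQ (hle hux' huy' hux huy h))
    -- Here `u < r ≤ u'`, so `z ≤ z'` and `f z ≤ f z' ≤ g z'`.
    · exact Or.inl ((hf hzQ hzQ' (hle hux huy hux' huy' (hu.2.le.trans hu'.1))).trans
        (hfg _ hzQ'))
    · exact Or.inr ((hf hzQ' hzQ (hle hux' huy' hux huy (hu'.2.le.trans hu.1))).trans
        (hfg _ hzQ))
    · rcases le_total u u' with h | h
      · exact Or.inl (hg hzQ hzQ' (hle hux huy hux' huy' h))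
      · exact Or.inr (hg hzQ' hzQ (hle hux' huy' hux huy h))
  · simp only [pushforward, Finset.sum_add_distrib]
    have hfib : ∀ (h : P × P → P) (F : P × P → ℝ), ∑ v, ∑ z with h z = v, F z = ∑ z, F z := by
      intro h F
      simp only [Finset.sum_filter]
      rw [Finset.sum_comm]
      simp
    refine (congr_arg₂ (· + ·) (hfib f _) (hfib g _)).trans ?_
    rw [sum_overlap hx hy le_rfl h1 h0, sum_overlap hx hy h0 le_rfl h1]
    ring

end Pushforward

end SimplicialRealization

/-! ### The subcomplex attached to a set of pairs of vertices. -/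

namespace SimplicialRealization

variable {P : Type*} [PartialOrder P]

/-- The set of points of the product of the order complex with itself whose carrier cell
has all its vertices in `Q`. -/
def supportedOn (Q : Set (P × P)) : Set ((P → ℝ) × (P → ℝ)) :=
  {p | p.1 ∈ realization (orderComplex P) ∧ p.2 ∈ realization (orderComplex P) ∧
    ∀ a b, p.1 a ≠ 0 → p.2 b ≠ 0 → (a, b) ∈ Q}

/-- The support condition says that for each `z ∉ Q` one of two coordinates vanishes, which is a
closed condition. -/
theorem isClosed_supportedOn [Finite P] (Q : Set (P × P)) : IsClosed (supportedOn Q) := by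
  have h1 : IsClosed (realization (orderComplex P)) := CWComplex.isClosed
  have : supportedOn Q = (realization (orderComplex P) ×ˢ realization (orderComplex P)) ∩
      ⋂ z ∈ Qᶜ, ({p | p.1 z.1 = 0} ∪ {p | p.2 z.2 = 0}) := by
    ext p
    simp only [supportedOn, mem_ofPred_eq, mem_inter_iff, mem_prod, mem_iInter, mem_compl_iff,
      mem_union, Prod.forall]
    grind
  rw [this]
  refine (h1.prod h1).inter (isClosed_biInter fun z _ => ?_)
  exact (isClosed_eq (by fun_prop) (by fun_prop)).union (isClosed_eq (by fun_prop) (by fun_prop))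

/-- The carrier of `x` is spanned by its support, a nonempty subset of a face. -/
theorem exists_mem_openSimplex {V : Type*} {K : AbstractSimplicialComplex V} {x : V → ℝ}
    (hx : x ∈ realization K) : ∃ (n : ℕ) (s : Cell K n), x ∈ openSimplex s.1 := by
  classical
  simp only [realization, mem_iUnion, exists_prop] at hx
  obtain ⟨s, hs, h0, h1, h2⟩ := hx
  have h3 : ∑ v ∈ s.filter (fun v => x v ≠ 0), x v = 1 := by
    rw [Finset.sum_filter_ne_zero, h2]
  have hne : (s.filter fun v => x v ≠ 0).Nonempty := by
    rw [Finset.nonempty_iff_ne_empty]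
    intro h
    rw [h] at h3
    simp at h3
  refine ⟨(s.filter fun v => x v ≠ 0).card - 1, ⟨s.filter fun v => x v ≠ 0,
    (K.isRelLowerSet_faces hs).2 (Finset.filter_subset _ _) hne, ?_⟩, fun v hv => ?_,
    fun v hv => ?_, h3⟩
  · have := hne.card_pos
    omega
  · exact (h0 v).lt_of_ne' (Finset.mem_filter.1 hv).2
  · by_contra h
    exact hv (Finset.mem_filter.2 ⟨by_contra fun hv' => h (h1 v hv'), h⟩)

theorem ne_zero_iff_of_mem_openSimplex {V : Type*} {s : Finset V} {x : V → ℝ}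
    (hx : x ∈ openSimplex s) {v : V} : x v ≠ 0 ↔ v ∈ s :=
  ⟨fun h => by_contra fun hv => h (hx.2.1 v hv), fun h => (hx.1 v h).ne'⟩

theorem openSimplex_subset_realization {V : Type*} {K : AbstractSimplicialComplex V} {s : Finset V}
    (hs : s ∈ K.faces) : openSimplex s ⊆ realization K := by
  intro x hx
  refine mem_biUnion hs ⟨fun v => ?_, hx.2⟩
  by_cases hv : v ∈ s
  · exact (hx.1 v hv).le
  · exact (hx.2.1 v hv).ge

theorem openCell_prod [Finite P] {n : ℕ}
    (c : CWProd.Cell (realization (orderComplex P)) (realization (orderComplex P)) n) :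
    RelCWComplex.openCell
      (C := realization (orderComplex P) ×ˢ realization (orderComplex P)) n c =
      openSimplex (Subtype.val (show Cell (orderComplex P) c.1.1.1 from c.2.1)) ×ˢ
        openSimplex (Subtype.val (show Cell (orderComplex P) c.1.1.2 from c.2.2)) := by
  refine (CWProd.image_ball n c).trans (congr_arg₂ _ ?_ ?_)
  · exact image_ball _ _
  · exact image_ball _ _

/-- The subcomplex of the product complex of all the products of simplices whose vertices lie
in `Q`. -/
def supportedSubcomplex [Finite P] (Q : Set (P × P)) : RelCWComplex.Subcomplex
    (realization (orderComplex P) ×ˢ realization (orderComplex P)) where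
  carrier := supportedOn Q
  I n := {c : CWProd.Cell (realization (orderComplex P)) (realization (orderComplex P)) n |
    ∀ a ∈ Subtype.val (show Cell (orderComplex P) c.1.1.1 from c.2.1),
    ∀ b ∈ Subtype.val (show Cell (orderComplex P) c.1.1.2 from c.2.2), (a, b) ∈ Q}
  closed' := isClosed_supportedOn Q
  union' := by
    rw [empty_union]
    ext ⟨x, y⟩
    simp only [mem_iUnion]
    constructor
    · rintro ⟨n, ⟨c, hc⟩, hxy⟩
      obtain ⟨hx, hy⟩ := (openCell_prod (P := P) c).subset hxy
      refine ⟨openSimplex_subset_realization (Subtype.prop (show Cell _ _ from c.2.1)).1 hx,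
        openSimplex_subset_realization (Subtype.prop (show Cell _ _ from c.2.2)).1 hy,
        fun a b ha hb => hc a ((ne_zero_iff_of_mem_openSimplex hx).1 ha) b
          ((ne_zero_iff_of_mem_openSimplex hy).1 hb)⟩
    · rintro ⟨hx, hy, h⟩
      obtain ⟨k, s, hs⟩ := exists_mem_openSimplex hx
      obtain ⟨l, t, ht⟩ := exists_mem_openSimplex hy
      refine ⟨k + l, ⟨⟨⟨⟨k, l⟩, rfl⟩, s, t⟩, fun a ha b hb => ?_⟩,
        (openCell_prod (P := P) ⟨⟨⟨k, l⟩, rfl⟩, s, t⟩).superset ⟨hs, ht⟩⟩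
      exact h a b ((ne_zero_iff_of_mem_openSimplex hs).2 ha)
        ((ne_zero_iff_of_mem_openSimplex ht).2 hb)

/-- The supports of `x` and `y` have greatest elements `m` and `k`. A set `Q i` containing `(m, k)`
contains every pair of support vertices, being a lower set. -/
theorem iUnion_supportedOn [Finite P] {ι : Type*} {Q : ι → Set (P × P)}
    (hQ : ∀ i, IsLowerSet (Q i)) (h : ⋃ i, Q i = univ) :
    ⋃ i, supportedOn (Q i) = realization (orderComplex P) ×ˢ realization (orderComplex P) := by
  have := Fintype.ofFinite P
  have hmax : ∀ {x}, x ∈ realization (orderComplex P) → ∃ m, ∀ a, x a ≠ 0 → a ≤ m := by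
    intro x hx
    obtain ⟨-, hc, h1⟩ := mem_realization_orderComplex.1 hx
    have hne : {a | x a ≠ 0}.Nonempty := by
      by_contra! hemp
      rw [Finset.sum_eq_zero fun a _ => by_contra fun ha => (hemp ▸ ha : a ∈ (∅ : Set P))] at h1
      exact zero_ne_one h1
    obtain ⟨m, -, hm⟩ := (Set.toFinite {a | x a ≠ 0}).exists_le_maximal hne.choose_spec
    refine ⟨m, fun a ha => ?_⟩
    rcases hc.total ha hm.prop with h' | h'
    · exact h'
    · exact hm.le_of_ge ha h'
  refine Subset.antisymm (iUnion_subset fun i p hp => ⟨hp.1, hp.2.1⟩) fun p hp => ?_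
  obtain ⟨m, hm⟩ := hmax hp.1
  obtain ⟨k, hk⟩ := hmax hp.2
  obtain ⟨i, hi⟩ := mem_iUnion.1 (h.superset (mem_univ (m, k)))
  exact mem_iUnion.2 ⟨i, hp.1, hp.2, fun a b ha hb => hQ i (Prod.mk_le_mk.2 ⟨hm a ha, hk b hb⟩) hi⟩

/-! ### Homotopies from comparable monotone maps, and sections from homotopies. -/

section Homotopy

variable [Fintype P] {Q : Set (P × P)}

/-- The map from the points supported on `Q` to the order complex induced by a monotone map. -/
noncomputable def inducedMap (f : P × P → P) (hf : MonotoneOn f Q) :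
    C(supportedOn Q, realization (orderComplex P)) where
  toFun p := ⟨pushforward f f p.1.1 p.1.2 1, pushforward_mem p.2.1 p.2.2.1 p.2.2.2 hf hf
    (fun _ _ => le_rfl) zero_le_one le_rfl⟩
  continuous_toFun := (continuous_pushforward f f (by fun_prop) (by fun_prop)
    continuous_const).subtype_mk _

theorem inducedMap_homotopic {f g : P × P → P} (hf : MonotoneOn f Q) (hg : MonotoneOn g Q)
    (hfg : ∀ z ∈ Q, f z ≤ g z) : (inducedMap f hf).Homotopic (inducedMap g hg) :=
  -- The switching point is `1 - t`, so that time `0` gives `f`, the smaller map.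
  ⟨{ toFun := fun p => ⟨pushforward f g p.2.1.1 p.2.1.2 (1 - p.1),
        pushforward_mem p.2.2.1 p.2.2.2.1 p.2.2.2.2 hf hg hfg (by linarith [p.1.2.2])
          (by linarith [p.1.2.1])⟩
     continuous_toFun := (continuous_pushforward f g (by fun_prop) (by fun_prop)
        (by fun_prop)).subtype_mk _
     map_zero_left := fun p => Subtype.ext (by
        simpa using! pushforward_one f g p.1.1 p.1.2)
     map_one_left := fun p => Subtype.ext (by
        simpa using! pushforward_zero f g p.1.1 p.1.2) }⟩

/-- The projections of `P × P` induce the projections of the pair `(x, y)`, so the curried homotopy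
is a path from `x` to `y` depending continuously on the pair. -/
theorem exists_section_of_homotopic (hfst : MonotoneOn Prod.fst Q) (hsnd : MonotoneOn Prod.snd Q)
    (h : (inducedMap Prod.fst hfst).Homotopic (inducedMap Prod.snd hsnd)) :
    ∃ s : supportedOn Q → C(unitInterval, realization (orderComplex P)), Continuous s ∧
      ∀ p, ((s p 0 : P → ℝ), (s p 1 : P → ℝ)) = (p : (P → ℝ) × (P → ℝ)) := by
  obtain ⟨H⟩ := h
  refine ⟨ContinuousMap.curry (H.toContinuousMap.comp ContinuousMap.prodSwap),
    ContinuousMap.continuous _, fun p => Prod.ext ?_ ?_⟩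
  · exact (congr_arg Subtype.val (H.map_zero_left p)).trans (pushforward_fst p.2.1 p.2.2.1)
  · exact (congr_arg Subtype.val (H.map_one_left p)).trans (pushforward_snd p.2.1 p.2.2.1)

end Homotopy

end SimplicialRealization

/-! ### From continuity to order: open sets of products and maps on their subsets. -/

/-- Specialization in a product topology is componentwise, and in each factor it is the order. -/
theorem IsOpen.isLowerSet_prod {P R : Type*} [Preorder P] [TopologicalSpace P]
    [Topology.IsLowerSet P] [Preorder R] [TopologicalSpace R] [Topology.IsLowerSet R]
    {Q : Set (P × R)} (hQ : IsOpen Q) : IsLowerSet Q := fun _ _ hwz hz =>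
  ((Topology.IsLowerSet.specializes_iff_le.2 hwz.1).prod
    (Topology.IsLowerSet.specializes_iff_le.2 hwz.2)).mem_open hQ hz

/-- Continuous maps preserve specialization, which on both sides corresponds to the order. -/
theorem Continuous.monotone_of_subtype_prod {P R S : Type*} [Preorder P] [TopologicalSpace P]
    [Topology.IsLowerSet P] [Preorder R] [TopologicalSpace R] [Topology.IsLowerSet R]
    [Preorder S] [TopologicalSpace S] [Topology.IsLowerSet S] {Q : Set (P × R)} {s : Q → S}
    (hs : Continuous s) : Monotone s := fun _ _ hzw => by
  rw [← Topology.IsLowerSet.specializes_iff_le]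
  refine Specializes.map ?_ hs
  rw [subtype_specializes_iff]
  exact (Topology.IsLowerSet.specializes_iff_le.2 hzw.1).prod
    (Topology.IsLowerSet.specializes_iff_le.2 hzw.2)

/-! ### Homotopy along the fence, and the theorem. -/

open SimplicialRealization in
theorem inducedMap_fst_homotopic_snd {P : Type*} [PartialOrder P] [Fintype P] [TopologicalSpace P]
    [Topology.IsLowerSet P] {Q : Set (P × P)} {m : ℕ} {s : Q → CombPath P m} (hs : Continuous s)
    (hend : ∀ z : Q, (s z).endpoints = (z : P × P)) :
    (inducedMap (Q := Q) Prod.fst (monotone_fst.monotoneOn Q)).Homotopic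
      (inducedMap Prod.snd (monotone_snd.monotoneOn Q)) := by
  classical
  -- The value off `Q` is arbitrary: only monotonicity and inequalities on `Q` enter.
  let F : Fence m → P × P → P := fun i z => if h : z ∈ Q then (s ⟨z, h⟩).1 i else z.1
  have hF : ∀ i, ∀ z (h : z ∈ Q), F i z = (s ⟨z, h⟩).1 i := fun i z h => dif_pos h
  have hmono : ∀ i, MonotoneOn (F i) Q := by
    intro i z hz w hw hzw
    rw [hF i z hz, hF i w hw]
    exact hs.monotone_of_subtype_prod (show (⟨z, hz⟩ : Q) ≤ ⟨w, hw⟩ from hzw) i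
  have hle : ∀ i j, i ≤ j → ∀ z ∈ Q, F i z ≤ F j z := by
    intro i j hij z hz
    rw [hF i z hz, hF j z hz]
    exact Topology.IsLowerSet.monotone_iff_continuous.2 (s ⟨z, hz⟩).2 hij
  have hstep : ∀ (k : ℕ) (hk : k < m + 1),
      (inducedMap (F (Fence.first m)) (hmono _)).Homotopic
        (inducedMap (F (⟨k, hk⟩ : Fin (m + 1))) (hmono _)) := by
    intro k
    induction k with
    | zero => exact fun _ => ContinuousMap.Homotopic.refl _
    | succ k ih =>
      intro hk
      refine (ih (by omega)).trans ?_
      rcases Nat.even_or_odd k with hev | hodd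
      · exact inducedMap_homotopic _ _
          (hle (⟨k, by omega⟩ : Fin (m + 1)) (⟨k + 1, hk⟩ : Fin (m + 1)) (Or.inr ⟨hev, Or.inl rfl⟩))
      -- For odd `k` the even point `k + 1` lies below `k`, so the homotopy runs backwards and is
      -- reversed.
      · exact (inducedMap_homotopic _ _ (hle (⟨k + 1, hk⟩ : Fin (m + 1))
          (⟨k, by omega⟩ : Fin (m + 1)) (Or.inr ⟨hodd.add_one, Or.inr rfl⟩))).symm
  -- The end maps of `F` agree with the projections on `Q` but need not off it, so the equalities on
  -- `Q` are used as inequalities giving two further homotopies.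
  refine ((inducedMap_homotopic _ (hmono (Fence.first m)) fun z hz => ?_).trans
    (hstep m (by omega))).trans (inducedMap_homotopic _ _ fun z hz => ?_)
  · rw [hF _ z hz]
    exact (congr_arg Prod.fst (hend ⟨z, hz⟩)).ge
  · exact (hF (Fence.last m) z hz).le.trans (congr_arg Prod.snd (hend ⟨z, hz⟩)).le

theorem theorem4 (P : Type*) [PartialOrder P] [Finite P] [TopologicalSpace P]
    [Topology.IsLowerSet P] [PathConnectedSpace P] :
    cellularComplexity (realization (orderComplex P)) ≤ combComplexity P := by
  have := Fintype.ofFinite P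
  refine le_iInf fun m => le_iInf₂ ?_
  rintro n ⟨Q, hQ, hcover, hsec⟩
  -- The cover by the subcomplexes attached to the `Q i` has the same number `n` of members,
  -- whatever the fence length `m`.
  refine iInf₂_le n ⟨fun i => SimplicialRealization.supportedSubcomplex (Q i),
    SimplicialRealization.iUnion_supportedOn (fun i => (hQ i).isLowerSet_prod) hcover,
    fun i => ?_⟩
  obtain ⟨s, hs, hend⟩ := hsec i
  exact SimplicialRealization.exists_section_of_homotopic _ _ (inducedMap_fst_homotopic_snd hs hend)
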